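/- Let $m\le n$, $A\in\mathbb R^{m\times n}$, $L\in\mathbb R^{p\times n}$ with $\operatorname{rank}[A^T,L^T]^T=n$, ${\bf b}\in\mathbb R^m$, let $\bar\sigma_1\ge\dots\ge\bar\sigma_m\ge 0$ be the singular values of $A$, and let $\|\cdot\|$ be the Euclidean or spectral norm and $\dagger$ the Moore–Penrose inverse. Let $U^TAX=\Sigma_A$, $V^TLX=\Sigma_L$ be a generalized singular value decomposition of $\{A,L\}$, with $U,V$ orthogonal, $X$ nonsingular, nonzero parts $\operatorname{diag}(\alpha_i)$ of $\Sigma_A$ (lower right corner) and $\operatorname{diag}(\beta_i)$ of $\Sigma_L$ (upper left corner), $0\le\alpha_1\le\dots\le\alpha_n\le 1$, $\beta_i\ge0$, $\alpha_i^2+\beta_i^2=1$. Let $\epsilon>0$, $\lambda>0$, and suppose that for some target rank $0\le k<m$ and real constants $\bar c_1,\bar c_2,K_1,K_2$ $$|\epsilon-\bar c_1\bar\sigma_{k+1}|\le K_1\bar\sigma_{k+1}^2,\qquad |\lambda-\bar c_2\bar\sigma_{k+1}|\le K_2\bar\sigma_{k+1}^2 .$$ Let ${\bf x}_\lambda\neq{\bf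 0}$ be the minimizer of $\|A{\bf x}-{\bf b}\|^2+\lambda^2\|L{\bf x}\|^2$. For a matrix $B$ with $N$ columns and a random $N\times N$ test matrix $\Omega$ with independent entries that are uniform on $[-\sqrt3,\sqrt3]$, a range finder output for $B$ with tolerance $\epsilon$ is a matrix $Q$ with $\ell\le N$ orthonormal columns such that $B\,\Omega(:,1:\ell)=QR$ with $R$ upper triangular with nonzero diagonal, and $\|B-QQ^TB\|\le\epsilon$. In the two-sided randomized algorithm for $m\le n$, $Q\in\mathbb R^{n\times\ell_1}$ is a range finder output for $A^T$ with test matrix $\Omega_Q$, and then $P\in\mathbb R^{m\times\ell_2}$ is a range finder output for $AQ$ with a fresh test matrix $\Omega_P$, both with tolerance $\epsilon$. Put $$\mathcal A=\begin{bmatrix}A\\ \lambda L\end{bmatrix},\quad \tilde{\mathcal A}=\begin{bmatrix}PP^TA\\ \lambda L\end{bmatrix},\quad \tilde{\mathcal A}QQ^T=\begin{bmatrix}PP^TAQQ^T\\ \lambda LQQ^T\end{bmatrix},$$ and let ${\bf x}_\lambda^R$ be the minimum-norm least-squares solution of $\min_{\bf x}\|\tilde{\mathcal A}QQ^T{\bf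 x}-[{\bf b}^T,{\bf 0}^T]^T\|$. Let $c=(1+\sqrt5)/2$, $\tilde\nu_\lambda=\|{\bf b}\|/\|{\bf x}_\lambda\|$, $\nu_\lambda=\|\mathcal A^\dagger\|\tilde\nu_\lambda$, $\kappa(\mathcal A)=\|\mathcal A\|\|\mathcal A^\dagger\|$, $\gamma_1=\|L(QQ^T-I)\|$, $\gamma_2=\|X^{-1}\|\sqrt{\|X\|^2+\bar c_2^2}$. Then, with probability one over $\Omega_Q$ and then over $\Omega_P$, for all such $Q$ and $P$: if $n\le \ell_2+\operatorname{rank}L$, then $\tilde{\mathcal A}$ has full column rank $n$; and $$\frac{\|{\bf x}_\lambda^R-{\bf x}_\lambda\|}{\|{\bf x}_\lambda\|}\le \|\mathcal A^\dagger\|\Big(c\bar c_1(\xi\tilde\nu_\lambda+\nu_\lambda)+c\bar c_2\gamma_1\nu_\lambda+(1+c\,\kappa(\mathcal A)\nu_\lambda)\gamma_2\Big)\bar\sigma_{k+1}+\|\mathcal A^\dagger\|\Big(cK_1(\xi\tilde\nu_\lambda+\nu_\lambda)+cK_2\gamma_1\nu_\lambda\Big)\bar\sigma_{k+1}^2$$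 holds with $\xi=\|(\tilde{\mathcal A}QQ^T)^\dagger\|$, and also with $\xi=\|\tilde{\mathcal A}^\dagger\|$ whenever $\tilde{\mathcal A}$ has full column rank $n$. -/

import Mathlib

open MeasureTheory ProbabilityTheory
open scoped Matrix Matrix.Norms.L2Operator

/-! Conventions: vectors of `ℝⁿ` live in `EuclideanSpace ℝ (Fin n)`; the norm `‖M‖` of a matrix is the
spectral norm (operator norm for the Euclidean norms). -/

section PseudoInverse

variable {ι κ : Type*} [Fintype ι] [Fintype κ] [DecidableEq κ]

/-- `N` is the Moore–Penrose inverse of the real matrix `M`: the four Penrose equations. -/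
structure IsMoorePenrose (M : Matrix ι κ ℝ) (N : Matrix κ ι ℝ) : Prop where
  mul_mul_self : M * N * M = M
  self_mul_mul : N * M * N = N
  symm_left : (M * N)ᵀ = M * N
  symm_right : (N * M)ᵀ = N * M

/-- Every real matrix has a Moore–Penrose inverse. -/
theorem exists_isMoorePenrose (M : Matrix ι κ ℝ) : ∃ N, IsMoorePenrose M N := by
  have hH : (Mᵀ * M).IsHermitian := by
    have h := Matrix.isHermitian_conjTranspose_mul_self M
    rwa [Matrix.conjTranspose_eq_transpose_of_trivial] at h
  set U : Matrix κ κ ℝ := (hH.eigenvectorUnitary : Matrix κ κ ℝ) with hU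
  set d : κ → ℝ := hH.eigenvalues with hd
  have hUU : Uᵀ * U = 1 := by
    have h := (Matrix.mem_unitaryGroup_iff').1 hH.eigenvectorUnitary.2
    rwa [Matrix.star_eq_conjTranspose, Matrix.conjTranspose_eq_transpose_of_trivial] at h
  have hspec : Mᵀ * M = U * Matrix.diagonal d * Uᵀ := by
    have h := hH.spectral_theorem
    rw [Unitary.conjStarAlgAut_apply] at h
    have e : (RCLike.ofReal ∘ hH.eigenvalues : κ → ℝ) = d := by
      funext i; simp [hd]
    rw [e, Matrix.star_eq_conjTranspose,
      Matrix.conjTranspose_eq_transpose_of_trivial] at h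
    exact h
  set H : Matrix κ κ ℝ := Mᵀ * M with hHdef
  set G : Matrix κ κ ℝ := U * Matrix.diagonal (fun i => (d i)⁻¹) * Uᵀ with hG
  have hmul : ∀ a b : κ → ℝ, (U * Matrix.diagonal a * Uᵀ) * (U * Matrix.diagonal b * Uᵀ)
      = U * Matrix.diagonal (fun i => a i * b i) * Uᵀ := by
    intro a b
    calc (U * Matrix.diagonal a * Uᵀ) * (U * Matrix.diagonal b * Uᵀ)
        = U * Matrix.diagonal a * (Uᵀ * U) * Matrix.diagonal b * Uᵀ := by
          simp only [Matrix.mul_assoc]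
      _ = _ := by
          rw [hUU, Matrix.mul_one, Matrix.mul_assoc U, Matrix.diagonal_mul_diagonal]
  have htr : ∀ a : κ → ℝ, (U * Matrix.diagonal a * Uᵀ)ᵀ = U * Matrix.diagonal a * Uᵀ := by
    intro a
    simp [Matrix.transpose_mul, Matrix.mul_assoc]
  have hGT : Gᵀ = G := htr _
  have hHT : Hᵀ = H := by rw [hspec]; exact htr _
  have hGHT : (G * H)ᵀ = G * H := by rw [hspec, hG, hmul]; exact htr _
  have hHGH : H * (G * H) = H := by
    rw [hspec, hG, hmul, hmul]
    congr 3
    funext i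
    by_cases h : d i = 0
    · simp [h]
    · field_simp
  have hGHG : G * H * G = G := by
    rw [hspec, hG, hmul, hmul]
    congr 3
    funext i
    by_cases h : d i = 0
    · simp [h]
    · field_simp
  have hM : M * (G * H) = M := by
    have h0 : (M * (G * H) - M)ᵀ * (M * (G * H) - M) = 0 := by
      have e : (M * (G * H) - M)ᵀ = (G * H - 1) * Mᵀ := by
        rw [Matrix.transpose_sub, Matrix.transpose_mul, hGHT, Matrix.sub_mul, Matrix.one_mul]
      have e2 : M * (G * H) - M = M * (G * H - 1) := by
        rw [Matrix.mul_sub, Matrix.mul_one]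
      rw [e, e2, Matrix.mul_assoc, ← Matrix.mul_assoc Mᵀ M, ← hHdef, Matrix.mul_sub,
        hHGH, Matrix.mul_one, sub_self, Matrix.mul_zero]
    have h1 : M * (G * H) - M = 0 := by
      rw [← Matrix.conjTranspose_mul_self_eq_zero, Matrix.conjTranspose_eq_transpose_of_trivial]
      exact h0
    exact sub_eq_zero.1 h1
  refine ⟨G * Mᵀ, ?_, ?_, ?_, ?_⟩
  · rw [Matrix.mul_assoc, Matrix.mul_assoc G, ← hHdef, hM]
  · rw [Matrix.mul_assoc G Mᵀ M, ← hHdef, ← Matrix.mul_assoc, hGHG]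
  · rw [Matrix.transpose_mul, Matrix.transpose_mul, hGT, Matrix.transpose_transpose,
      Matrix.mul_assoc]
  · rw [Matrix.mul_assoc, ← hHdef, hGHT]

/-- The Moore–Penrose inverse `M†`. -/
noncomputable def pinv (M : Matrix ι κ ℝ) : Matrix κ ι ℝ :=
  (exists_isMoorePenrose M).choose

theorem isMoorePenrose_pinv (M : Matrix ι κ ℝ) : IsMoorePenrose M (pinv M) :=
  (exists_isMoorePenrose M).choose_spec

/-- `x` is the least-squares solution of `min ‖M x - y‖` of minimum Euclidean norm. -/
def IsMinNormLeastSquares (M : Matrix ι κ ℝ) (y : EuclideanSpace ℝ ι)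
    (x : EuclideanSpace ℝ κ) : Prop :=
  (∀ z, ‖Matrix.toEuclideanLin M x - y‖ ≤ ‖Matrix.toEuclideanLin M z - y‖) ∧
  ∀ z, (∀ w, ‖Matrix.toEuclideanLin M z - y‖ ≤ ‖Matrix.toEuclideanLin M w - y‖) → ‖x‖ ≤ ‖z‖

end PseudoInverse

/-- `{A, L}` is a Grassman matrix pair: `rank [Aᵀ, Lᵀ]ᵀ = n`. -/
def IsGMP {m p n : ℕ} (A : Matrix (Fin m) (Fin n) ℝ) (L : Matrix (Fin p) (Fin n) ℝ) : Prop :=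
  (Matrix.fromRows A L).rank = n

/-- `x` solves the Tikhonov problem `min ‖A x - b‖² + lam² ‖L x‖²`. -/
def IsTikhonovSolution {m p n : ℕ} (A : Matrix (Fin m) (Fin n) ℝ) (L : Matrix (Fin p) (Fin n) ℝ)
    (lam : ℝ) (b : EuclideanSpace ℝ (Fin m)) (x : EuclideanSpace ℝ (Fin n)) : Prop :=
  ∀ z, ‖Matrix.toEuclideanLin A x - b‖ ^ 2 + lam ^ 2 * ‖Matrix.toEuclideanLin L x‖ ^ 2
    ≤ ‖Matrix.toEuclideanLin A z - b‖ ^ 2 + lam ^ 2 * ‖Matrix.toEuclideanLin L z‖ ^ 2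

/-- The stacked right-hand side `[bᵀ, 0ᵀ]ᵀ`. -/
def stackedRhs {m : ℕ} (p : ℕ) (b : EuclideanSpace ℝ (Fin m)) :
    EuclideanSpace ℝ (Fin m ⊕ Fin p) :=
  WithLp.toLp 2 (Sum.elim (fun i => b i) (fun _ => 0))

/-- The `(k+1)`-st largest singular value of `A` (index `k` counted from `0`). -/
noncomputable def sval {m n : ℕ} (A : Matrix (Fin m) (Fin n) ℝ) (k : ℕ) : ℝ :=
  (Matrix.toEuclideanLin A).singularValues k

/-- The generalized singular value decomposition of the pair `{A, L}`:
`Uᵀ A X = [0 0; 0 D₁]` with `D₁` in the lower right corner and `Vᵀ L X = [D₂ 0; 0 0]` with `D₂` in the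
upper left corner, the generalized singular values `α i / β i` being in nondecreasing order.
`D₁` holds the nonzero `α i` and `D₂` the nonzero `β i`; the block sizes are the numbers of the `α i`
that are `0`, strictly between `0` and `1`, and `1`. -/
structure IsGSVD {m p n : ℕ} (A : Matrix (Fin m) (Fin n) ℝ) (L : Matrix (Fin p) (Fin n) ℝ)
    (U : Matrix (Fin m) (Fin m) ℝ) (V : Matrix (Fin p) (Fin p) ℝ) (X : Matrix (Fin n) (Fin n) ℝ)
    (α β : Fin n → ℝ) : Prop where
  orthU : Uᵀ * U = 1
  orthV : Vᵀ * V = 1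
  nonsingular : IsUnit X.det
  α_nonneg : ∀ j, 0 ≤ α j
  β_nonneg : ∀ j, 0 ≤ β j
  sq_add_sq : ∀ j, α j ^ 2 + β j ^ 2 = 1
  α_mono : Monotone α
  α_zero : ∀ j : Fin n, (j : ℕ) + m < n → α j = 0
  β_zero : ∀ j : Fin n, p ≤ (j : ℕ) → β j = 0
  eqA : Uᵀ * A * X = Matrix.of fun (i : Fin m) (j : Fin n) =>
    if (i : ℕ) + n = (j : ℕ) + m then α j else 0
  eqL : Vᵀ * L * X = Matrix.of fun (i : Fin p) (j : Fin n) =>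
    if (i : ℕ) = (j : ℕ) then β j else 0

/-- The law of an `N × ℓ` uniform random matrix: the entries are independent and uniformly
distributed on `[-√3, √3]`. -/
noncomputable def uniformMatrixLaw (N ℓ : ℕ) : Measure (Fin N → Fin ℓ → ℝ) :=
  Measure.pi fun _ => Measure.pi fun _ => (volume : Measure ℝ)[|Set.Icc (-√3) √3]

/-- `Q` (with `ℓ` columns) is an approximate basis matrix for the range of `B`, computed from the
random test matrix `Ω` within the tolerance `ε`: `Q` has orthonormal columns, it is the factor of a
reduced QR decomposition of `B` times the first `ℓ` columns of `Ω`, and `‖B - Q Qᵀ B‖ ≤ ε`.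

`Ω` collects all the blocks of columns that the blockwise adaptive range finder may draw. That
algorithm orthogonalizes the columns of `B Ω` one after the other, in blocks of any size, keeps those
whose diagonal entry in `R` exceeds `ε`, and stops at the first other one; so what it keeps has the form
described here, whatever the block size, and the stopping rule only selects the number `ℓ`. -/
def IsRangeFinderOutput {M N ℓ : ℕ} (B : Matrix (Fin M) (Fin N) ℝ) (ε : ℝ)
    (Ω : Fin N → Fin N → ℝ) (Q : Matrix (Fin M) (Fin ℓ) ℝ) : Prop :=
  Qᵀ * Q = 1 ∧
  (∃ (h : ℓ ≤ N) (R : Matrix (Fin ℓ) (Fin ℓ) ℝ),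
    (∀ i j, j < i → R i j = 0) ∧ (∀ j, R j j ≠ 0) ∧
    B * (Matrix.of Ω).submatrix id (Fin.castLE h) = Q * R) ∧
  ‖B - Q * Qᵀ * B‖ ≤ ε

/-! ### Generic sketches: full column rank for almost every test matrix. -/

section GenericSketch

/-! Write `M` for the stacked matrix of `A` and `lam • L`, `T = Q * Qᵀ`, and `B = B * T` for the
two-sided matrix. On the range of `T` the `L` blocks of `M` and `B` agree and the `A` blocks differ
by at most `ε`, while `M * (1 - T)` has norm at most `ε + lam * γ₁`. The proof goes through `y =
pinv (M * T) v`, the minimizer of the full problem over the range of `T`. Passing from `pinv M v` to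
`y` costs only what `T` discards (`norm_map_leastSquares_sub_le`). Passing from `y` to `pinv B v` is
split along `v = M y + (v - M y)`: the first part is controlled by the size of `B - M` on the range
of `T`, the second by an angle argument (`norm_pinv_apply_le_of_orthogonal`).
`norm_pinv_sub_pinv_le` combines these.

For the rank claim, a kernel vector of the projected stack has the form `W y`, the columns of `W`
being a basis of `ker L`. The QR relations turn `Pᵀ A W y = 0` into the vanishing of a sketch of `Qᵀ
Aᵀ A W y`, and likewise `Qᵀ Aᵀ A W y = 0` into that of a sketch of `A Aᵀ A W y`. Generic sketches
preserve injectivity, and `A Aᵀ A W` is injective because `ker A` and `ker L` meet only in zero. -/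

theorem MeasureTheory.Measure.pi_smul_restrict {ι E : Type*} [Fintype ι] [MeasurableSpace E]
    (μ : Measure E) [SigmaFinite μ] (s : Set E) (a : ENNReal) (ha : a ≠ ⊤) :
    (Measure.pi fun _ : ι => a • μ.restrict s)
      = a ^ Fintype.card ι • (Measure.pi fun _ : ι => μ).restrict (Set.univ.pi fun _ => s) := by
  lift a to NNReal using ha
  have : SigmaFinite ((a : ENNReal) • μ.restrict s) :=
    inferInstanceAs (SigmaFinite (a • μ.restrict s))
  refine Measure.pi_eq fun t _ => ?_
  rw [Measure.restrict_pi_pi]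
  simp [Measure.pi_pi, Finset.prod_mul_distrib]

theorem uniformMatrixLaw_absolutelyContinuous (N ℓ : ℕ) :
    uniformMatrixLaw N ℓ ≪ (volume : Measure (Fin N → Fin ℓ → ℝ)) := by
  have hc : (volume (Set.Icc (-√3) √3))⁻¹ ≠ (⊤ : ENNReal) := by
    rw [Real.volume_Icc]
    simp
  unfold uniformMatrixLaw ProbabilityTheory.cond
  rw [Measure.pi_smul_restrict _ _ _ hc,
    Measure.pi_smul_restrict _ _ _ (ENNReal.pow_ne_top hc)]
  exact (Measure.smul_absolutelyContinuous).trans Measure.absolutelyContinuous_restrict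

/-- A measurable set that meets every line through a fixed point outside a null set of
parameters is a null set. -/
theorem addHaar_eq_zero_of_ae_lineMap_notMem {E : Type*} [NormedAddCommGroup E] [NormedSpace ℝ E]
    [MeasurableSpace E] [BorelSpace E] [FiniteDimensional ℝ E] (μ : Measure E)
    [μ.IsAddHaarMeasure] (S : Set E) (hS : MeasurableSet S) (x₀ : E)
    (h : ∀ v : E, ∀ᵐ t : ℝ, x₀ + t • v ∉ S) : μ S = 0 := by
  have hmeas : Measurable fun q : E × ℝ => x₀ + q.2 • q.1 := by fun_prop
  have h1 : ∀ᵐ q ∂(μ.prod (volume : Measure ℝ)), x₀ + q.2 • q.1 ∉ S := by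
    rw [Measure.ae_prod_iff_ae_ae]
    · exact Filter.Eventually.of_forall h
    · exact (hmeas hS).compl
  have h2 : ∀ᵐ t : ℝ, ∀ᵐ v ∂μ, x₀ + t • v ∉ S := by
    have h1' : ∀ᵐ q ∂((volume : Measure ℝ).prod μ), x₀ + q.1 • q.2 ∉ S := by
      rw [← Measure.prod_swap]
      have hm : Measurable fun q : ℝ × E => x₀ + q.1 • q.2 := by fun_prop
      exact (ae_map_iff measurable_swap.aemeasurable (hm hS).compl).2 h1
    exact Measure.ae_ae_of_ae_prod h1'
  have h3 : ∀ᵐ t : ℝ, t ≠ 0 := by simp [ae_iff]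
  obtain ⟨t, ht, ht0⟩ := (h2.and h3).exists
  have h4 : μ ((fun v => t • v) ⁻¹' ((fun w => x₀ + w) ⁻¹' S)) = 0 := by
    rw [ae_iff] at ht
    simp only [not_not] at ht
    exact ht
  rw [Measure.addHaar_preimage_smul μ ht0, measure_preimage_add] at h4
  simpa [ht0] using h4

/-- The determinant is a polynomial in `t` that does not vanish at `0`, so it has finitely many
roots. -/
theorem ae_det_add_smul_ne_zero {r : ℕ} (M₀ M₁ : Matrix (Fin r) (Fin r) ℝ) (h : M₀.det ≠ 0) :
    ∀ᵐ t : ℝ, (M₀ + t • M₁).det ≠ 0 := by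
  set q : Polynomial ℝ :=
    (M₀.map Polynomial.C + (Polynomial.X : Polynomial ℝ) • M₁.map Polynomial.C).det with hq
  have hev : ∀ t, q.eval t = (M₀ + t • M₁).det := by
    intro t
    rw [hq, ← Polynomial.coe_evalRingHom, RingHom.map_det]
    congr 1
    ext i j
    simp [mul_comm t]
  have hq0 : q ≠ 0 := by
    intro h0
    apply h
    have := hev 0
    simpa [h0] using this.symm
  have : {t : ℝ | ¬ (M₀ + t • M₁).det ≠ 0} ⊆ {t | q.IsRoot t} := by
    intro t ht
    simpa [Polynomial.IsRoot, hev] using ht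
  exact ((Polynomial.finite_setOfPred_isRoot hq0).subset this).measure_zero _

/-- For a matrix `G` of full column rank, almost every sketch `Ω(:, 1:ℓ)ᵀ G` with at least as many
rows as columns has full column rank. -/
theorem ae_sketch_mulVec_injective {N r : ℕ} (hr : r ≤ N) (G : Matrix (Fin N) (Fin r) ℝ)
    (hG : Function.Injective G.mulVec) :
    ∀ᵐ Ω ∂(uniformMatrixLaw N N), ∀ (ℓ : ℕ) (h : ℓ ≤ N), r ≤ ℓ →
      ∀ y, (((Matrix.of Ω).submatrix id (Fin.castLE h))ᵀ * G) *ᵥ y = 0 → y = 0 := by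
  -- Only the first `r` rows of the sketch are tested, so one null set serves every `ℓ ≥ r`.
  set D : (Fin N → Fin N → ℝ) → Matrix (Fin r) (Fin r) ℝ :=
    fun Ω => ((Matrix.of Ω).submatrix id (Fin.castLE hr))ᵀ * G with hD
  have hDc : Continuous fun Ω => (D Ω).det := by
    refine Continuous.matrix_det ?_
    refine continuous_matrix fun i j => ?_
    simp only [hD, Matrix.mul_apply, Matrix.transpose_apply, Matrix.submatrix_apply, Matrix.of_apply]
    fun_prop
  have hnull : (volume : Measure (Fin N → Fin N → ℝ)) {Ω | (D Ω).det = 0} = 0 := by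
    -- `G` padded with zero columns: its sketch is the Gram matrix of `G`, which is nonsingular.
    let Ω₀ : Fin N → Fin N → ℝ := fun i j => if h : (j : ℕ) < r then G i ⟨j, h⟩ else 0
    have h0 : D Ω₀ = Gᵀ * G := by
      ext i j
      simp [hD, Ω₀, Matrix.mul_apply]
    have h0d : (D Ω₀).det ≠ 0 := by
      intro hdet
      obtain ⟨v, hv, hv0⟩ := Matrix.exists_mulVec_eq_zero_iff.2 hdet
      rw [h0] at hv0
      have : G *ᵥ v = 0 := by
        have h1 : v ∈ LinearMap.ker (Gᵀ * G).mulVecLin := hv0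
        rwa [Matrix.ker_mulVecLin_transpose_mul_self] at h1
      exact hv (hG (by simpa using this))
    refine addHaar_eq_zero_of_ae_lineMap_notMem _ _
      (isClosed_singleton.preimage hDc).measurableSet Ω₀ fun W => ?_
    filter_upwards [ae_det_add_smul_ne_zero (D Ω₀) (D W) h0d] with t ht
    have : D (Ω₀ + t • W) = D Ω₀ + t • D W := by
      ext i j
      simp [hD, Matrix.mul_apply, Finset.mul_sum, add_mul, Finset.sum_add_distrib, mul_assoc]
    simpa [this] using ht
  have hae : ∀ᵐ Ω ∂(uniformMatrixLaw N N), (D Ω).det ≠ 0 := by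
    refine (uniformMatrixLaw_absolutelyContinuous N N).ae_le (ae_iff.2 ?_)
    simpa only [ne_eq, not_not] using hnull
  filter_upwards [hae] with Ω hΩ ℓ h hrl y hy
  refine Matrix.eq_zero_of_mulVec_eq_zero hΩ ?_
  funext i
  have := congrFun hy (Fin.castLE hrl i)
  simpa [hD, Matrix.mulVec, dotProduct, Matrix.mul_apply] using this

end GenericSketch

set_option linter.unusedSectionVars false

/-! ### Least squares and the Moore–Penrose inverse. -/

section LeastSquares

variable {ι κ μ : Type*} [Fintype ι] [Fintype κ] [DecidableEq κ] [Fintype μ] [DecidableEq μ]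

theorem Matrix.norm_toEuclideanLin_le (M : Matrix ι κ ℝ) (x : EuclideanSpace ℝ κ) :
    ‖Matrix.toEuclideanLin M x‖ ≤ ‖M‖ * ‖x‖ :=
  M.l2_opNorm_mulVec x

theorem Matrix.l2_opNorm_le_of_forall (M : Matrix ι κ ℝ) {C : ℝ} (hC : 0 ≤ C)
    (h : ∀ x, ‖Matrix.toEuclideanLin M x‖ ≤ C * ‖x‖) : ‖M‖ ≤ C := by
  rw [Matrix.l2_opNorm_def]
  exact ContinuousLinearMap.opNorm_le_bound _ hC h

theorem Matrix.toEuclideanLin_mul_apply (M : Matrix ι κ ℝ) (N : Matrix κ μ ℝ)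
    (x : EuclideanSpace ℝ μ) :
    Matrix.toEuclideanLin (M * N) x = Matrix.toEuclideanLin M (Matrix.toEuclideanLin N x) := by
  rw [Matrix.toLpLin_mul (q := 2)]
  rfl

theorem Matrix.inner_toEuclideanLin_left [DecidableEq ι] (M : Matrix ι κ ℝ)
    (x : EuclideanSpace ℝ κ) (y : EuclideanSpace ℝ ι) :
    inner ℝ (Matrix.toEuclideanLin M x) y = inner ℝ x (Matrix.toEuclideanLin Mᵀ y) := by
  rw [← Matrix.conjTranspose_eq_transpose_of_trivial, Matrix.toEuclideanLin_conjTranspose_eq_adjoint,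
    LinearMap.adjoint_inner_right]

theorem Matrix.norm_transpose_l2 [DecidableEq ι] (M : Matrix ι κ ℝ) : ‖Mᵀ‖ = ‖M‖ := by
  rw [← Matrix.conjTranspose_eq_transpose_of_trivial, Matrix.l2_opNorm_conjTranspose]

/-- `‖s‖ ≤ θ ‖v‖` for the projection `s` of `v` on a line making an angle of sine at most `θ` with
a vector orthogonal to `v`. -/
theorem norm_le_of_inner_eq_of_norm_sub_le {E : Type*} [NormedAddCommGroup E]
    [InnerProductSpace ℝ E] {s u v : E} {θ : ℝ} (huv : inner ℝ u v = 0)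
    (hsv : inner ℝ s v = ‖s‖ ^ 2) (hθ : 0 ≤ θ) (h : ‖s - u‖ ≤ θ * ‖u‖) : ‖s‖ ≤ θ * ‖v‖ := by
  rcases eq_or_ne u 0 with rfl | hu
  · have : ‖s‖ ≤ 0 := by simpa using h
    exact this.trans (by positivity)
  have hu' : 0 < ‖u‖ := norm_pos_iff.2 hu
  -- `‖u‖ ^ 2` times the component of `s` orthogonal to `u`; the scaling avoids a division. Since `u
  -- ⊥ v`, pairing `w` with `v` sees only `s`.
  set w : E := ‖u‖ ^ 2 • s - inner ℝ s u • u with hw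
  have hwn : ‖w‖ ^ 2 = ‖u‖ ^ 2 * (‖s‖ ^ 2 * ‖u‖ ^ 2 - inner ℝ s u ^ 2) := by
    rw [hw, norm_sub_sq_real, norm_smul, norm_smul, inner_smul_left, inner_smul_right]
    simp only [Real.norm_eq_abs, mul_pow, sq_abs, conj_trivial]
    ring
  have hgram : ‖s‖ ^ 2 * ‖u‖ ^ 2 - inner ℝ s u ^ 2 ≤ ‖s‖ ^ 2 * ‖s - u‖ ^ 2 := by
    rw [norm_sub_sq_real]
    nlinarith [sq_nonneg (‖s‖ ^ 2 - inner ℝ s u)]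
  have hw2 : ‖w‖ ≤ θ * ‖s‖ * ‖u‖ ^ 2 := by
    refine abs_le_of_sq_le_sq' ?_ (by positivity) |>.2
    rw [hwn]
    have h2 : ‖s - u‖ ^ 2 ≤ (θ * ‖u‖) ^ 2 := by gcongr
    calc ‖u‖ ^ 2 * (‖s‖ ^ 2 * ‖u‖ ^ 2 - inner ℝ s u ^ 2)
        ≤ ‖u‖ ^ 2 * (‖s‖ ^ 2 * (θ * ‖u‖) ^ 2) := by
          have := mul_le_mul_of_nonneg_left h2 (sq_nonneg ‖s‖)
          gcongr
          linarith
      _ = (θ * ‖s‖ * ‖u‖ ^ 2) ^ 2 := by ring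
  have hin : ‖u‖ ^ 2 * ‖s‖ ^ 2 ≤ θ * ‖s‖ * ‖u‖ ^ 2 * ‖v‖ := by
    have h3 : inner ℝ w v = ‖u‖ ^ 2 * ‖s‖ ^ 2 := by
      rw [hw, inner_sub_left, inner_smul_left, inner_smul_left, huv, hsv]
      simp
    rw [← h3]
    exact (real_inner_le_norm _ _).trans (by gcongr)
  rcases (norm_nonneg s).eq_or_lt with h0 | h0
  · rw [← h0]; positivity
  · have : ‖u‖ ^ 2 * ‖s‖ * ‖s‖ ≤ ‖u‖ ^ 2 * ‖s‖ * (θ * ‖v‖) := by nlinarith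
    exact le_of_mul_le_mul_left this (by positivity)

namespace IsMoorePenrose

variable [DecidableEq ι] {M : Matrix ι κ ℝ} {N : Matrix κ ι ℝ}

theorem inner_residual (h : IsMoorePenrose M N) (v : EuclideanSpace ℝ ι)
    (x : EuclideanSpace ℝ κ) :
    inner ℝ (v - Matrix.toEuclideanLin M (Matrix.toEuclideanLin N v))
      (Matrix.toEuclideanLin M x) = 0 := by
  rw [inner_sub_left, ← Matrix.toEuclideanLin_mul_apply, Matrix.inner_toEuclideanLin_left,
    h.symm_left, ← Matrix.toEuclideanLin_mul_apply, h.mul_mul_self, sub_self]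

theorem norm_proj_le (h : IsMoorePenrose M N) (v : EuclideanSpace ℝ ι) :
    ‖Matrix.toEuclideanLin M (Matrix.toEuclideanLin N v)‖ ≤ ‖v‖ := by
  have h1 := norm_add_sq_eq_norm_sq_add_norm_sq_of_inner_eq_zero _ _
    (h.inner_residual v (Matrix.toEuclideanLin N v))
  rw [sub_add_cancel] at h1
  nlinarith [norm_nonneg v,
    norm_nonneg (v - Matrix.toEuclideanLin M (Matrix.toEuclideanLin N v)),
    norm_nonneg (Matrix.toEuclideanLin M (Matrix.toEuclideanLin N v))]

theorem map_eq_of_leastSquares (h : IsMoorePenrose M N) {v : EuclideanSpace ℝ ι}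
    {x : EuclideanSpace ℝ κ}
    (hx : ∀ z, ‖Matrix.toEuclideanLin M x - v‖ ≤ ‖Matrix.toEuclideanLin M z - v‖) :
    Matrix.toEuclideanLin M x = Matrix.toEuclideanLin M (Matrix.toEuclideanLin N v) := by
  set p := Matrix.toEuclideanLin M (Matrix.toEuclideanLin N v) with hp
  have h1 := norm_sub_sq_eq_norm_sq_add_norm_sq_real
    (h.inner_residual v (x - Matrix.toEuclideanLin N v))
  have e : v - p - Matrix.toEuclideanLin M (x - Matrix.toEuclideanLin N v)
      = v - Matrix.toEuclideanLin M x := by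
    rw [map_sub, ← hp]; abel
  rw [← hp, e, norm_sub_rev v, norm_sub_rev v, map_sub, ← hp] at h1
  have h2 := hx (Matrix.toEuclideanLin N v)
  rw [← hp] at h2
  rw [← sub_eq_zero, ← norm_eq_zero]
  nlinarith [norm_nonneg (Matrix.toEuclideanLin M x - v), norm_nonneg (p - v),
    norm_nonneg (Matrix.toEuclideanLin M x - p)]

theorem leastSquares (h : IsMoorePenrose M N) (v : EuclideanSpace ℝ ι)
    (z : EuclideanSpace ℝ κ) :
    ‖Matrix.toEuclideanLin M (Matrix.toEuclideanLin N v) - v‖ ≤ ‖Matrix.toEuclideanLin M z - v‖ := by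
  set p := Matrix.toEuclideanLin M (Matrix.toEuclideanLin N v) with hp
  have h1 := norm_sub_sq_eq_norm_sq_add_norm_sq_real
    (h.inner_residual v (z - Matrix.toEuclideanLin N v))
  have e : v - p - Matrix.toEuclideanLin M (z - Matrix.toEuclideanLin N v)
      = v - Matrix.toEuclideanLin M z := by
    rw [map_sub, ← hp]; abel
  rw [← hp, e, norm_sub_rev v, norm_sub_rev v, map_sub, ← hp] at h1
  refine abs_le_of_sq_le_sq' ?_ (norm_nonneg _) |>.2
  nlinarith [norm_nonneg (Matrix.toEuclideanLin M z - p)]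

/-- `x` and `N v` have the same image under `M`, so `N v = N M x` is the orthogonal projection of
`x` onto the range of `N M`. As `‖x‖ ≤ ‖N v‖`, Pythagoras forces equality. -/
theorem eq_of_isMinNormLeastSquares (h : IsMoorePenrose M N) {v : EuclideanSpace ℝ ι}
    {x : EuclideanSpace ℝ κ} (hx : IsMinNormLeastSquares M v x) :
    x = Matrix.toEuclideanLin N v := by
  have h1 := h.map_eq_of_leastSquares hx.1
  have h2 := hx.2 _ (h.leastSquares v)
  have h3 : Matrix.toEuclideanLin N (Matrix.toEuclideanLin M x) = Matrix.toEuclideanLin N v := by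
    rw [h1, ← Matrix.toEuclideanLin_mul_apply, ← Matrix.toEuclideanLin_mul_apply, h.self_mul_mul]
  have h4 : inner ℝ (Matrix.toEuclideanLin N v) (x - Matrix.toEuclideanLin N v) = 0 := by
    conv_lhs => rw [← h3, ← Matrix.toEuclideanLin_mul_apply, Matrix.inner_toEuclideanLin_left,
      h.symm_right]
    rw [Matrix.toEuclideanLin_mul_apply N M x, h3, Matrix.toEuclideanLin_mul_apply, map_sub, h1, sub_self, map_zero, inner_zero_right]
  have h5 := norm_add_sq_eq_norm_sq_add_norm_sq_of_inner_eq_zero _ _ h4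
  rw [add_sub_cancel] at h5
  rw [← sub_eq_zero, ← norm_eq_zero]
  nlinarith [norm_nonneg (x - Matrix.toEuclideanLin N v), norm_nonneg x]

theorem mul_eq_one_of_injective (h : IsMoorePenrose M N) (hM : Function.Injective M.mulVec) :
    N * M = 1 := by
  refine Matrix.ext_of_mulVec_single fun i => hM ?_
  rw [Matrix.mulVec_mulVec, Matrix.mulVec_mulVec, ← Matrix.mul_assoc, h.mul_mul_self, Matrix.mul_one]

/-- `N = Mᵀ Nᵀ N` has its columns in the range of `Mᵀ`, which `T` fixes. -/
theorem mul_eq_of_transpose_mul (h : IsMoorePenrose M N) {T : Matrix κ κ ℝ} (hTt : Tᵀ = T)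
    (hMT : M * T = M) : T * N = N := by
  have e : N = Mᵀ * (Nᵀ * N) := by
    rw [← Matrix.mul_assoc, ← Matrix.transpose_mul, h.symm_right, h.self_mul_mul]
  have e2 : T * Mᵀ = Mᵀ := by rw [← hTt, ← Matrix.transpose_mul, hMT]
  rw [e, ← Matrix.mul_assoc, e2, ← e]

end IsMoorePenrose

/-- `T` fixes the columns of `pinv (M * T)`, so the latter is `pinv M` times the orthogonal
projection onto the range of `M * T`. -/
theorem norm_pinv_mul_le_norm_pinv [DecidableEq ι] {M : Matrix ι κ ℝ}
    (hM : Function.Injective M.mulVec) {T : Matrix κ κ ℝ} (hTt : Tᵀ = T) (hTT : T * T = T) :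
    ‖pinv (M * T)‖ ≤ ‖pinv M‖ := by
  have h := isMoorePenrose_pinv (M * T)
  have h1 := (isMoorePenrose_pinv M).mul_eq_one_of_injective hM
  have h2 : T * pinv (M * T) = pinv (M * T) :=
    h.mul_eq_of_transpose_mul hTt (by rw [Matrix.mul_assoc, hTT])
  have h3 : pinv (M * T) = pinv M * (M * T * pinv (M * T)) := by
    rw [Matrix.mul_assoc M, ← Matrix.mul_assoc (pinv M), h1, Matrix.one_mul, h2]
  rw [h3]
  refine (Matrix.l2_opNorm_mul _ _).trans (mul_le_of_le_one_right (norm_nonneg _) ?_)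
  refine Matrix.l2_opNorm_le_of_forall _ zero_le_one fun x => ?_
  rw [Matrix.toEuclideanLin_mul_apply, one_mul]
  exact h.norm_proj_le x

end LeastSquares

/-! ### Perturbation of a least squares problem restricted to a subspace. -/

section Perturbation

variable {ι κ : Type*} [Fintype ι] [Fintype κ] [DecidableEq ι] [DecidableEq κ]

/-- Already `√2` would do as the constant. -/
theorem add_le_goldenRatio_mul {x y z : ℝ} (h : x ^ 2 + y ^ 2 = z ^ 2) (hz : 0 ≤ z) :
    x + y ≤ (1 + √5) / 2 * z := by
  have h5 : √5 ^ 2 = 5 := Real.sq_sqrt (by norm_num)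
  have h52 : 2 ≤ √5 := Real.le_sqrt_of_sq_le (by norm_num)
  refine abs_le_of_sq_le_sq' ?_ (by positivity) |>.2
  nlinarith [sq_nonneg (x - y), sq_nonneg z]

/-- The component of `pinv B v` coming from the part of `v` orthogonal to the range of `M` on the
range of the projection `T`, when `B` is close to `M` there. -/
theorem norm_pinv_apply_le_of_orthogonal {M B : Matrix ι κ ℝ} {T : Matrix κ κ ℝ} {a ε : ℝ}
    (ha0 : 0 ≤ a) (hε : 0 ≤ ε)
    (ha : ∀ x, ‖x‖ ≤ a * ‖Matrix.toEuclideanLin M x‖) (hTt : Tᵀ = T) (hBT : B * T = B)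
    (hF : ∀ z, Matrix.toEuclideanLin T z = z →
      ‖Matrix.toEuclideanLin B z - Matrix.toEuclideanLin M z‖ ≤ ε * ‖z‖)
    {r : EuclideanSpace ℝ ι}
    (hr : ∀ z, Matrix.toEuclideanLin T z = z → inner ℝ r (Matrix.toEuclideanLin M z) = 0) :
    ‖Matrix.toEuclideanLin (pinv B) r‖ ≤ ‖pinv B‖ * (a * ε * ‖r‖) := by
  have h := isMoorePenrose_pinv B
  have hTB := h.mul_eq_of_transpose_mul hTt hBT
  set w := Matrix.toEuclideanLin (pinv B) r with hw
  set s := Matrix.toEuclideanLin B w with hs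
  have hTw : Matrix.toEuclideanLin T w = w := by
    rw [hw, ← Matrix.toEuclideanLin_mul_apply, hTB]
  have hws : w = Matrix.toEuclideanLin (pinv B) s := by
    rw [hs, hw, ← Matrix.toEuclideanLin_mul_apply, ← Matrix.toEuclideanLin_mul_apply,
      h.self_mul_mul]
  have hsr : inner ℝ s r = ‖s‖ ^ 2 := by
    have := h.inner_residual r w
    rw [inner_sub_left, ← hw, ← hs, real_inner_self_eq_norm_sq, real_inner_comm] at this
    linarith
  have hle : ‖s‖ ≤ a * ε * ‖r‖ := by
    -- `s` is the projection of `r` on the range of `B`, and `M w ⊥ r`. The angle between `s` and `M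
    -- w` has sine at most `a * ε`.
    refine norm_le_of_inner_eq_of_norm_sub_le (u := Matrix.toEuclideanLin M w) ?_ hsr
      (by positivity) ?_
    · rw [real_inner_comm]; exact hr w hTw
    · calc _ ≤ ε * ‖w‖ := hF w hTw
        _ ≤ ε * (a * ‖Matrix.toEuclideanLin M w‖) := by gcongr; exact ha w
        _ = _ := by ring
  rw [hws]
  exact (Matrix.norm_toEuclideanLin_le _ _).trans (by gcongr)

/-- The minimizer `y` of `‖M z - v‖` over the range of the projection `T` is, in the seminorm
`‖M ·‖`, at least as close to `x = pinv M v` as `T x` is. -/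
theorem norm_map_leastSquares_sub_le {M : Matrix ι κ ℝ} {T : Matrix κ κ ℝ} (hTT : T * T = T)
    {v : EuclideanSpace ℝ ι} {y : EuclideanSpace ℝ κ} (hTy : Matrix.toEuclideanLin T y = y)
    (hr : ∀ z, Matrix.toEuclideanLin T z = z →
      inner ℝ (v - Matrix.toEuclideanLin M y) (Matrix.toEuclideanLin M z) = 0) :
    ‖Matrix.toEuclideanLin M (y - Matrix.toEuclideanLin (pinv M) v)‖ ≤
      ‖Matrix.toEuclideanLin M (Matrix.toEuclideanLin (pinv M) v -
        Matrix.toEuclideanLin T (Matrix.toEuclideanLin (pinv M) v))‖ := by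
  set x := Matrix.toEuclideanLin (pinv M) v with hx
  set d := Matrix.toEuclideanLin M (y - x) with hd
  set e := Matrix.toEuclideanLin M (y - Matrix.toEuclideanLin T x) with he
  have h1 := hr (y - Matrix.toEuclideanLin T x)
    (by rw [map_sub, hTy, ← Matrix.toEuclideanLin_mul_apply, hTT])
  have h2 := (isMoorePenrose_pinv M).inner_residual v (y - Matrix.toEuclideanLin T x)
  rw [← hx, ← he] at h2
  rw [← he] at h1
  -- The residuals at `x` and at `y` are both orthogonal to `M` applied to the range of `T`, hence
  -- so is their difference `d`.
  have hort : inner ℝ d e = 0 := by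
    have hde : d = (v - Matrix.toEuclideanLin M x) - (v - Matrix.toEuclideanLin M y) := by
      rw [hd, map_sub]; abel
    rw [hde, inner_sub_left, h2, h1, sub_zero]
  have h3 := norm_sub_sq_eq_norm_sq_add_norm_sq_real hort
  have hxe : Matrix.toEuclideanLin M (x - Matrix.toEuclideanLin T x) = -(d - e) := by
    rw [hd, he, ← map_sub, ← map_neg]
    congr 1
    abel
  rw [hxe, norm_neg]
  refine abs_le_of_sq_le_sq' ?_ (norm_nonneg _) |>.2
  rw [sq, sq, h3]
  exact le_add_of_nonneg_right (mul_self_nonneg _)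

set_option maxHeartbeats 1000000 in
/-- Perturbation bound for the least squares problem `min ‖M x - v‖`, for `M` of full column rank,
under replacement of `M` by a matrix `B = B T` that is close to `M` on the range of the orthogonal
projection `T`. -/
theorem norm_pinv_sub_pinv_le {M B : Matrix ι κ ℝ} {T : Matrix κ κ ℝ} {ε η : ℝ}
    (hε : 0 ≤ ε) (hη : 0 ≤ η) (hM : Function.Injective M.mulVec)
    (hTt : Tᵀ = T) (hTT : T * T = T) (hBT : B * T = B)
    (hF : ∀ z, Matrix.toEuclideanLin T z = z →
      ‖Matrix.toEuclideanLin B z - Matrix.toEuclideanLin M z‖ ≤ ε * ‖z‖)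
    (hD : ∀ x, ‖Matrix.toEuclideanLin M (x - Matrix.toEuclideanLin T x)‖ ≤ (ε + η) * ‖x‖)
    (v : EuclideanSpace ℝ ι) :
    ‖Matrix.toEuclideanLin (pinv B) v - Matrix.toEuclideanLin (pinv M) v‖ ≤
      ‖pinv M‖ * ((1 + √5) / 2) * ((‖pinv B‖ + ‖pinv M‖) * ε + ‖pinv M‖ * η) * ‖v‖ := by
  have hc1 : 1 ≤ (1 + √5) / 2 := by
    have : 1 ≤ √5 := Real.le_sqrt_of_sq_le (by norm_num)
    linarith
  set c := (1 + √5) / 2 with hc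
  set a := ‖pinv M‖ with ha_def
  set ξ := ‖pinv B‖ with hξ_def
  have ha0 : 0 ≤ a := norm_nonneg _
  have hξ0 : 0 ≤ ξ := norm_nonneg _
  have hv0 : 0 ≤ ‖v‖ := norm_nonneg _
  have hpM := isMoorePenrose_pinv M
  have hpB := isMoorePenrose_pinv B
  have hMM := hpM.mul_eq_one_of_injective hM
  have ha : ∀ x, ‖x‖ ≤ a * ‖Matrix.toEuclideanLin M x‖ := by
    intro x
    have : x = Matrix.toEuclideanLin (pinv M) (Matrix.toEuclideanLin M x) := by
      rw [← Matrix.toEuclideanLin_mul_apply, hMM]; simp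
    conv_lhs => rw [this]
    exact Matrix.norm_toEuclideanLin_le _ _
  set x := Matrix.toEuclideanLin (pinv M) v with hx
  have hxv : ‖x‖ ≤ a * ‖v‖ := Matrix.norm_toEuclideanLin_le _ _
  -- If `a * ε ≥ 1`, the triangle inequality suffices; otherwise `B` is injective on the range of
  -- `T`, which gives `pinv B (B y) = y`.
  rcases le_or_gt 1 (a * ε) with hbig | hsmall
  · have h1 : ‖Matrix.toEuclideanLin (pinv B) v‖ ≤ ξ * ‖v‖ := Matrix.norm_toEuclideanLin_le _ _
    calc _ ≤ ‖Matrix.toEuclideanLin (pinv B) v‖ + ‖x‖ := norm_sub_le _ _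
      _ ≤ 1 * 1 * ((ξ + a) * ‖v‖) := by linarith
      _ ≤ (a * ε) * c * ((ξ + a) * ‖v‖) := by gcongr
      _ ≤ (a * ε) * c * ((ξ + a) * ‖v‖) + a * c * (a * η) * ‖v‖ :=
        le_add_of_nonneg_right (by positivity)
      _ = _ := by ring
  have hpT := isMoorePenrose_pinv (M * T)
  have hTB := hpB.mul_eq_of_transpose_mul hTt hBT
  have hTpT : T * pinv (M * T) = pinv (M * T) :=
    hpT.mul_eq_of_transpose_mul hTt (by rw [Matrix.mul_assoc, hTT])
  set y := Matrix.toEuclideanLin (pinv (M * T)) v with hy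
  have hTy : Matrix.toEuclideanLin T y = y := by
    rw [hy, ← Matrix.toEuclideanLin_mul_apply, hTpT]
  set u := Matrix.toEuclideanLin M y with hu
  have hr : ∀ z, Matrix.toEuclideanLin T z = z →
      inner ℝ (v - u) (Matrix.toEuclideanLin M z) = 0 := by
    intro z hz
    have := hpT.inner_residual v z
    rwa [← hy, Matrix.toEuclideanLin_mul_apply, Matrix.toEuclideanLin_mul_apply, hTy, hz, ← hu]
      at this
  have hpyth : ‖u‖ ^ 2 + ‖v - u‖ ^ 2 = ‖v‖ ^ 2 := by
    have := norm_add_sq_eq_norm_sq_add_norm_sq_of_inner_eq_zero _ _ (hr y hTy)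
    rw [← hu, sub_add_cancel] at this
    linarith
  have hBinj : ∀ z, Matrix.toEuclideanLin T z = z → Matrix.toEuclideanLin B z = 0 → z = 0 := by
    intro z hz hz0
    have h1 := hF z hz
    rw [hz0, zero_sub, norm_neg] at h1
    have h2 : ‖z‖ ≤ a * ε * ‖z‖ := (ha z).trans (by rw [mul_assoc]; gcongr)
    rw [← norm_eq_zero]
    nlinarith [norm_nonneg z]
  have hBy : Matrix.toEuclideanLin (pinv B) (Matrix.toEuclideanLin B y) = y := by
    rw [← sub_eq_zero]
    refine hBinj _ ?_ ?_
    · rw [map_sub, hTy, ← Matrix.toEuclideanLin_mul_apply, hTB]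
    · rw [map_sub, ← Matrix.toEuclideanLin_mul_apply, ← Matrix.toEuclideanLin_mul_apply,
        hpB.mul_mul_self, sub_self]
  have hfirst : ‖Matrix.toEuclideanLin (pinv B) v - y‖ ≤ ξ * (a * ε * (c * ‖v‖)) := by
    have e : Matrix.toEuclideanLin (pinv B) v - y = Matrix.toEuclideanLin (pinv B) (v - u)
        - Matrix.toEuclideanLin (pinv B) (Matrix.toEuclideanLin B y - u) := by
      rw [map_sub, map_sub, hBy]; abel
    have h1 := norm_pinv_apply_le_of_orthogonal ha0 hε ha hTt hBT hF hr
    have h2 : ‖Matrix.toEuclideanLin (pinv B) (Matrix.toEuclideanLin B y - u)‖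
        ≤ ξ * (a * ε * ‖u‖) := by
      refine (Matrix.norm_toEuclideanLin_le _ _).trans ?_
      gcongr
      calc _ ≤ ε * ‖y‖ := hF y hTy
        _ ≤ ε * (a * ‖u‖) := by gcongr; exact ha y
        _ = _ := by ring
    rw [e]
    calc _ ≤ ξ * (a * ε * ‖v - u‖) + ξ * (a * ε * ‖u‖) := (norm_sub_le _ _).trans (by gcongr)
      _ = ξ * (a * ε * (‖u‖ + ‖v - u‖)) := by ring
      _ ≤ _ := by
        gcongr
        exact add_le_goldenRatio_mul hpyth hv0
  have hsecond : ‖y - x‖ ≤ a * ((ε + η) * (a * ‖v‖)) := by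
    refine (ha _).trans ?_
    gcongr
    exact (norm_map_leastSquares_sub_le hTT hTy hr).trans ((hD x).trans (by gcongr))
  calc _ ≤ ‖Matrix.toEuclideanLin (pinv B) v - y‖ + ‖y - x‖ := norm_sub_le_norm_sub_add_norm_sub _ _ _
    _ ≤ ξ * (a * ε * (c * ‖v‖)) + 1 * (a * ((ε + η) * (a * ‖v‖))) := by linarith
    _ ≤ ξ * (a * ε * (c * ‖v‖)) + c * (a * ((ε + η) * (a * ‖v‖))) := by gcongr
    _ = _ := by ring

end Perturbation

/-! ### The Tikhonov problem as a stacked least squares problem. -/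

section Tikhonov

theorem norm_fromRows_apply_sub_stackedRhs_sq {m n p : ℕ} (A : Matrix (Fin m) (Fin n) ℝ)
    (L : Matrix (Fin p) (Fin n) ℝ) (b : EuclideanSpace ℝ (Fin m)) (x : EuclideanSpace ℝ (Fin n)) :
    ‖Matrix.toEuclideanLin (Matrix.fromRows A L) x - stackedRhs p b‖ ^ 2
      = ‖Matrix.toEuclideanLin A x - b‖ ^ 2 + ‖Matrix.toEuclideanLin L x‖ ^ 2 := by
  simp [EuclideanSpace.norm_sq_eq, Fintype.sum_sum_type, stackedRhs, Matrix.toLpLin_apply,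
    Matrix.fromRows_mulVec]

theorem norm_fromRows_apply_sq {m n p : ℕ} (A : Matrix (Fin m) (Fin n) ℝ)
    (L : Matrix (Fin p) (Fin n) ℝ) (x : EuclideanSpace ℝ (Fin n)) :
    ‖Matrix.toEuclideanLin (Matrix.fromRows A L) x‖ ^ 2
      = ‖Matrix.toEuclideanLin A x‖ ^ 2 + ‖Matrix.toEuclideanLin L x‖ ^ 2 := by
  simp [EuclideanSpace.norm_sq_eq, Fintype.sum_sum_type, Matrix.toLpLin_apply,
    Matrix.fromRows_mulVec]

theorem norm_stackedRhs {m : ℕ} (p : ℕ) (b : EuclideanSpace ℝ (Fin m)) :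
    ‖stackedRhs p b‖ = ‖b‖ := by
  simp [EuclideanSpace.norm_eq, Fintype.sum_sum_type, stackedRhs]

theorem norm_smul_toEuclideanLin_sq {p n : ℕ} (lam : ℝ) (L : Matrix (Fin p) (Fin n) ℝ)
    (x : EuclideanSpace ℝ (Fin n)) :
    ‖Matrix.toEuclideanLin (lam • L) x‖ ^ 2 = lam ^ 2 * ‖Matrix.toEuclideanLin L x‖ ^ 2 := by
  rw [map_smul, LinearMap.smul_apply, norm_smul, mul_pow, Real.norm_eq_abs, sq_abs]

theorem Matrix.mulVec_injective_of_rank_eq {ι : Type*} [Fintype ι] {n : ℕ}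
    {M : Matrix ι (Fin n) ℝ} (h : M.rank = n) : Function.Injective M.mulVec := by
  have h1 := LinearMap.finrank_range_add_finrank_ker M.mulVecLin
  have h2 : Module.finrank ℝ (LinearMap.range M.mulVecLin) = n := h
  rw [h2] at h1
  have h3 : Module.finrank ℝ (LinearMap.ker M.mulVecLin) = 0 := by
    simpa using h1
  exact LinearMap.ker_eq_bot.1 (Submodule.finrank_eq_zero.1 h3)

theorem Matrix.rank_eq_of_mulVec_injective {ι : Type*} [Fintype ι] {n : ℕ}
    {M : Matrix ι (Fin n) ℝ} (h : Function.Injective M.mulVec) : M.rank = n := by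
  have := LinearMap.finrank_range_of_inj (f := M.mulVecLin) h
  simpa [Matrix.rank] using this

theorem IsGMP.eq_zero {m n p : ℕ} {A : Matrix (Fin m) (Fin n) ℝ} {L : Matrix (Fin p) (Fin n) ℝ}
    (h : IsGMP A L) {x : Fin n → ℝ} (hA : A *ᵥ x = 0) (hL : L *ᵥ x = 0) : x = 0 := by
  refine Matrix.mulVec_injective_of_rank_eq h ?_
  rw [Matrix.fromRows_mulVec, hA, hL]
  ext i
  cases i <;> simp

theorem IsGMP.mulVec_injective {m n p : ℕ} {A : Matrix (Fin m) (Fin n) ℝ}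
    {L : Matrix (Fin p) (Fin n) ℝ} (h : IsGMP A L) {lam : ℝ} (hlam : lam ≠ 0) :
    Function.Injective (Matrix.fromRows A (lam • L)).mulVec := by
  refine (injective_iff_map_eq_zero (Matrix.fromRows A (lam • L)).mulVecLin).2 fun x hx => ?_
  rw [Matrix.mulVecLin_apply, Matrix.fromRows_mulVec] at hx
  refine h.eq_zero ?_ ?_
  · funext i; simpa using congrFun hx (Sum.inl i)
  · funext i
    simpa [Matrix.smul_mulVec, hlam] using congrFun hx (Sum.inr i)

theorem IsTikhonovSolution.eq_pinv_apply {m n p : ℕ} {A : Matrix (Fin m) (Fin n) ℝ}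
    {L : Matrix (Fin p) (Fin n) ℝ} (hAL : IsGMP A L) {lam : ℝ} (hlam : lam ≠ 0)
    {b : EuclideanSpace ℝ (Fin m)} {x : EuclideanSpace ℝ (Fin n)}
    (hx : IsTikhonovSolution A L lam b x) :
    x = Matrix.toEuclideanLin (pinv (Matrix.fromRows A (lam • L))) (stackedRhs p b) := by
  have h := isMoorePenrose_pinv (Matrix.fromRows A (lam • L))
  have h1 := h.mul_eq_one_of_injective (hAL.mulVec_injective hlam)
  have h2 := h.map_eq_of_leastSquares (v := stackedRhs p b) (x := x) fun z => by
    refine abs_le_of_sq_le_sq' ?_ (norm_nonneg _) |>.2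
    rw [norm_fromRows_apply_sub_stackedRhs_sq, norm_fromRows_apply_sub_stackedRhs_sq,
      norm_smul_toEuclideanLin_sq, norm_smul_toEuclideanLin_sq]
    exact hx z
  have h3 := congrArg (Matrix.toEuclideanLin (pinv (Matrix.fromRows A (lam • L)))) h2
  rw [← Matrix.toEuclideanLin_mul_apply, ← Matrix.toEuclideanLin_mul_apply, h1] at h3
  simpa using h3

end Tikhonov

/-! ### Almost sure full column rank of the projected stack. -/

section RangeFinder

/-- A basis of the null space of a matrix, as the columns of a matrix. -/
theorem Matrix.exists_nullSpace_basis {p n : ℕ} (L : Matrix (Fin p) (Fin n) ℝ) :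
    ∃ W : Matrix (Fin n) (Fin (n - L.rank)) ℝ, Function.Injective W.mulVec ∧ L * W = 0 ∧
      ∀ x, L *ᵥ x = 0 → ∃ y, x = W *ᵥ y := by
  have h1 := LinearMap.finrank_range_add_finrank_ker L.mulVecLin
  have h3 : Module.finrank ℝ (LinearMap.ker L.mulVecLin) = n - L.rank := by
    have h2 : Module.finrank ℝ (LinearMap.range L.mulVecLin) = L.rank := rfl
    rw [h2] at h1
    simp at h1
    omega
  let e : (Fin (n - L.rank) → ℝ) ≃ₗ[ℝ] LinearMap.ker L.mulVecLin :=
    LinearEquiv.ofFinrankEq _ _ (by simp [h3])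
  let f : (Fin (n - L.rank) → ℝ) →ₗ[ℝ] (Fin n → ℝ) := (Submodule.subtype _) ∘ₗ e.toLinearMap
  have hf : ∀ y, (LinearMap.toMatrix' f) *ᵥ y = (e y : Fin n → ℝ) := fun y => by
    rw [LinearMap.toMatrix'_mulVec]; rfl
  refine ⟨LinearMap.toMatrix' f, ?_, ?_, ?_⟩
  · intro y z hyz
    simp only [hf] at hyz
    exact e.injective (Subtype.ext hyz)
  · refine Matrix.ext_of_mulVec_single fun i => ?_
    rw [← Matrix.mulVec_mulVec, hf, Matrix.zero_mulVec]
    exact (e _).2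
  · intro x hx
    refine ⟨e.symm ⟨x, hx⟩, ?_⟩
    rw [hf, e.apply_symm_apply]

theorem Matrix.transpose_mulVec_mulVec_eq_zero {m n : ℕ} (A : Matrix (Fin m) (Fin n) ℝ)
    {x : Fin n → ℝ} (h : Aᵀ *ᵥ (A *ᵥ x) = 0) : A *ᵥ x = 0 := by
  have h1 : x ∈ LinearMap.ker (Aᵀ * A).mulVecLin := by
    rw [LinearMap.mem_ker, Matrix.mulVecLin_apply, ← Matrix.mulVec_mulVec, h]
  rwa [Matrix.ker_mulVecLin_transpose_mul_self] at h1

/-- If a vector is orthogonal to the columns of `Q`, its image under `Bᵀ` is orthogonal to the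
columns of the sketching matrix. -/
theorem IsRangeFinderOutput.sketch_mulVec_eq_zero {M N ℓ : ℕ} {B : Matrix (Fin M) (Fin N) ℝ} {ε : ℝ}
    {Ω : Fin N → Fin N → ℝ} {Q : Matrix (Fin M) (Fin ℓ) ℝ} (h : IsRangeFinderOutput B ε Ω Q)
    {z : Fin M → ℝ} (hz : Qᵀ *ᵥ z = 0) :
    ∃ hℓ : ℓ ≤ N, ((Matrix.of Ω).submatrix id (Fin.castLE hℓ))ᵀ *ᵥ (Bᵀ *ᵥ z) = 0 := by
  obtain ⟨-, ⟨hℓ, R, -, -, hR⟩, -⟩ := h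
  refine ⟨hℓ, ?_⟩
  rw [Matrix.mulVec_mulVec, ← Matrix.transpose_mul, hR, Matrix.transpose_mul,
    ← Matrix.mulVec_mulVec, hz, Matrix.mulVec_zero]

theorem IsRangeFinderOutput.card_le {M N ℓ : ℕ} {B : Matrix (Fin M) (Fin N) ℝ} {ε : ℝ}
    {Ω : Fin N → Fin N → ℝ} {Q : Matrix (Fin M) (Fin ℓ) ℝ} (h : IsRangeFinderOutput B ε Ω Q) :
    ℓ ≤ N := h.2.1.1

theorem Matrix.le_of_mulVec_injective {N r : ℕ} {G : Matrix (Fin N) (Fin r) ℝ}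
    (h : Function.Injective G.mulVec) : r ≤ N := by
  simpa using LinearMap.finrank_le_finrank_of_injective (f := G.mulVecLin) h

/-- The projected pair keeps full column rank almost surely once `ℓ₂` makes up for the rank
deficiency of `L`. -/
theorem ae_rank_fromRows_proj {m n p : ℕ} {A : Matrix (Fin m) (Fin n) ℝ}
    {L : Matrix (Fin p) (Fin n) ℝ} (hAL : IsGMP A L) (ε : ℝ) {lam : ℝ} (hlam : lam ≠ 0) :
    ∀ᵐ ΩQ ∂(uniformMatrixLaw m m),
    ∀ (ℓ₁ : ℕ) (Q : Matrix (Fin n) (Fin ℓ₁) ℝ), IsRangeFinderOutput Aᵀ ε ΩQ Q →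
    ∀ᵐ ΩP ∂(uniformMatrixLaw ℓ₁ ℓ₁),
    ∀ (ℓ₂ : ℕ) (P : Matrix (Fin m) (Fin ℓ₂) ℝ), IsRangeFinderOutput (A * Q) ε ΩP P →
      n ≤ ℓ₂ + L.rank → (Matrix.fromRows (P * Pᵀ * A) (lam • L)).rank = n := by
  obtain ⟨W, hW, hLW, hker⟩ := L.exists_nullSpace_basis
  have hAW : ∀ y, A *ᵥ (W *ᵥ y) = 0 → y = 0 := by
    intro y hy
    refine hW ?_
    rw [Matrix.mulVec_zero]
    refine hAL.eq_zero hy ?_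
    rw [Matrix.mulVec_mulVec, hLW, Matrix.zero_mulVec]
  -- Repeated use of `ker (Aᵀ A) = ker A`, for `A` and for `Aᵀ`, reduces this to `hAW`.
  have hG : Function.Injective (A * (Aᵀ * (A * W))).mulVec := by
    refine (injective_iff_map_eq_zero (A * (Aᵀ * (A * W))).mulVecLin).2 fun y hy => hAW y ?_
    simp only [Matrix.mulVecLin_apply, ← Matrix.mulVec_mulVec] at hy
    refine A.transpose_mulVec_mulVec_eq_zero ?_
    have := Aᵀ.transpose_mulVec_mulVec_eq_zero (x := A *ᵥ (W *ᵥ y))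
    rw [Matrix.transpose_transpose] at this
    exact this hy
  filter_upwards [ae_sketch_mulVec_injective (Matrix.le_of_mulVec_injective hG) _ hG]
    with ΩQ hΩQ ℓ₁ Q hQ
  -- Since `ℓ₂ ≤ ℓ₁`, the rank condition cannot hold in the first case.
  rcases lt_or_ge ℓ₁ (n - L.rank) with hlt | hge
  · refine Filter.Eventually.of_forall fun ΩP ℓ₂ P hP hn => ?_
    have := hP.card_le
    omega
  have hH : Function.Injective (Qᵀ * (Aᵀ * (A * W))).mulVec := by
    refine (injective_iff_map_eq_zero (Qᵀ * (Aᵀ * (A * W))).mulVecLin).2 fun y hy => ?_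
    rw [Matrix.mulVecLin_apply, ← Matrix.mulVec_mulVec] at hy
    obtain ⟨hℓ, h⟩ := hQ.sketch_mulVec_eq_zero hy
    refine hΩQ ℓ₁ hℓ hge y ?_
    rw [Matrix.transpose_transpose] at h
    simpa only [Matrix.mulVec_mulVec, Matrix.mul_assoc] using h
  filter_upwards [ae_sketch_mulVec_injective hge _ hH] with ΩP hΩP ℓ₂ P hP hn
  refine Matrix.rank_eq_of_mulVec_injective ?_
  refine (injective_iff_map_eq_zero (Matrix.fromRows (P * Pᵀ * A) (lam • L)).mulVecLin).2
    fun x hx => ?_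
  rw [Matrix.mulVecLin_apply, Matrix.fromRows_mulVec] at hx
  have hx1 : (P * Pᵀ * A) *ᵥ x = 0 := by
    funext i; simpa using congrFun hx (Sum.inl i)
  have hx2 : L *ᵥ x = 0 := by
    funext i
    simpa [Matrix.smul_mulVec, hlam] using congrFun hx (Sum.inr i)
  have hx3 : Pᵀ *ᵥ (A *ᵥ x) = 0 := by
    have := congrArg (fun v => Pᵀ *ᵥ v) hx1
    simpa only [Matrix.mulVec_mulVec, ← Matrix.mul_assoc, hP.1, Matrix.one_mul,
      Matrix.mulVec_zero] using this
  obtain ⟨y, rfl⟩ := hker x hx2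
  obtain ⟨hℓ, h⟩ := hP.sketch_mulVec_eq_zero hx3
  have hy : y = 0 := by
    refine hΩP ℓ₂ hℓ (by omega) y ?_
    simpa only [Matrix.transpose_mul, Matrix.mulVec_mulVec, Matrix.mul_assoc] using h
  rw [hy, Matrix.mulVec_zero]

end RangeFinder

/-! ### The error of the two-sided method in terms of `ε` and `lam`. -/

section ErrorBound

theorem Matrix.norm_transpose_apply_of_range {n ℓ : ℕ} {Q : Matrix (Fin n) (Fin ℓ) ℝ}
    {z : EuclideanSpace ℝ (Fin n)} (hz : Matrix.toEuclideanLin (Q * Qᵀ) z = z) :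
    ‖Matrix.toEuclideanLin Qᵀ z‖ = ‖z‖ := by
  rw [← sq_eq_sq₀ (norm_nonneg _) (norm_nonneg _), ← real_inner_self_eq_norm_sq,
    Matrix.inner_toEuclideanLin_left, Matrix.transpose_transpose,
    ← Matrix.toEuclideanLin_mul_apply, hz, real_inner_self_eq_norm_sq]

/-- The perturbation bound with `T = Q * Qᵀ` and `η = lam * ‖L * (Q * Qᵀ - 1)‖`. -/
theorem norm_twoSided_sub_le {m n p ℓ₁ ℓ₂ : ℕ} {A : Matrix (Fin m) (Fin n) ℝ}
    {L : Matrix (Fin p) (Fin n) ℝ} (hAL : IsGMP A L) {b : EuclideanSpace ℝ (Fin m)}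
    {ε lam : ℝ} (hε : 0 < ε) (hlam : 0 < lam)
    {Q : Matrix (Fin n) (Fin ℓ₁) ℝ} {P : Matrix (Fin m) (Fin ℓ₂) ℝ}
    (hQ : Qᵀ * Q = 1) (hQε : ‖Aᵀ - Q * Qᵀ * Aᵀ‖ ≤ ε)
    (hPε : ‖A * Q - P * Pᵀ * (A * Q)‖ ≤ ε)
    {x xR : EuclideanSpace ℝ (Fin n)} (hx : IsTikhonovSolution A L lam b x)
    (hxR : IsMinNormLeastSquares
      (Matrix.fromRows (P * Pᵀ * A * (Q * Qᵀ)) (lam • (L * (Q * Qᵀ)))) (stackedRhs p b) xR) :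
    ‖xR - x‖ ≤ ‖pinv (Matrix.fromRows A (lam • L))‖ * ((1 + √5) / 2) *
      ((‖pinv (Matrix.fromRows (P * Pᵀ * A * (Q * Qᵀ)) (lam • (L * (Q * Qᵀ))))‖
        + ‖pinv (Matrix.fromRows A (lam • L))‖) * ε
        + ‖pinv (Matrix.fromRows A (lam • L))‖ * (lam * ‖L * (Q * Qᵀ - 1)‖)) * ‖b‖ := by
  set T := Q * Qᵀ with hT
  have hTt : Tᵀ = T := by rw [hT, Matrix.transpose_mul, Matrix.transpose_transpose]
  have hTT : T * T = T := by
    rw [hT, Matrix.mul_assoc, ← Matrix.mul_assoc Qᵀ, hQ, Matrix.one_mul]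
  have hATε : ‖A - A * T‖ ≤ ε := by
    rw [← Matrix.norm_transpose_l2, Matrix.transpose_sub, Matrix.transpose_mul, hTt]
    exact hQε
  rw [hx.eq_pinv_apply hAL hlam.ne', (isMoorePenrose_pinv _).eq_of_isMinNormLeastSquares hxR,
    ← norm_stackedRhs p b]
  refine norm_pinv_sub_pinv_le hε.le (by positivity) (hAL.mulVec_injective hlam.ne') hTt hTT ?_ ?_ ?_ _
  · rw [Matrix.fromRows_mul, Matrix.mul_assoc (P * Pᵀ * A), hTT, Matrix.smul_mul,
      Matrix.mul_assoc L, hTT]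
  · intro z hz
    refine abs_le_of_sq_le_sq' ?_ (by positivity) |>.2
    -- With `T z = z` the `L` blocks cancel, and the remaining block factors through `Qᵀ`, an
    -- isometry on such `z`. So `hPε`, which only concerns `A * Q`, is enough.
    have e : Matrix.toEuclideanLin (Matrix.fromRows (P * Pᵀ * A * T) (lam • (L * T))) z -
        Matrix.toEuclideanLin (Matrix.fromRows A (lam • L)) z
        = -Matrix.toEuclideanLin (Matrix.fromRows (A * Q * Qᵀ - P * Pᵀ * (A * Q) * Qᵀ)
          (0 : Matrix (Fin p) (Fin n) ℝ)) z := by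
      have e1 : Matrix.fromRows (P * Pᵀ * A * T) (lam • (L * T))
          = Matrix.fromRows (P * Pᵀ * A) (lam • L) * T := by
        rw [Matrix.fromRows_mul, Matrix.smul_mul]
      have e2 : Matrix.fromRows (A * Q * Qᵀ - P * Pᵀ * (A * Q) * Qᵀ) (0 : Matrix (Fin p) (Fin n) ℝ)
          = Matrix.fromRows (A - P * Pᵀ * A) 0 * T := by
        rw [Matrix.fromRows_mul, Matrix.sub_mul, Matrix.zero_mul, hT]
        simp only [Matrix.mul_assoc]
      have e3 : Matrix.fromRows (A - P * Pᵀ * A) (0 : Matrix (Fin p) (Fin n) ℝ)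
          = Matrix.fromRows A (lam • L) - Matrix.fromRows (P * Pᵀ * A) (lam • L) := by
        ext i j
        cases i <;> simp
      rw [e1, e2, Matrix.toEuclideanLin_mul_apply _ T, Matrix.toEuclideanLin_mul_apply _ T, hz, e3,
        map_sub, LinearMap.sub_apply]
      abel
    rw [e, norm_neg, norm_fromRows_apply_sq, map_zero, LinearMap.zero_apply, norm_zero,
      ← Matrix.sub_mul, Matrix.toEuclideanLin_mul_apply]
    have h1 := (A * Q - P * Pᵀ * (A * Q)).norm_toEuclideanLin_le (Matrix.toEuclideanLin Qᵀ z)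
    rw [Matrix.norm_transpose_apply_of_range hz] at h1
    have h2 := h1.trans (mul_le_mul_of_nonneg_right hPε (norm_nonneg z))
    have h3 := pow_le_pow_left₀ (norm_nonneg _) h2 2
    simpa using h3
  · intro z
    refine abs_le_of_sq_le_sq' ?_ (by positivity) |>.2
    have h1 : ‖Matrix.toEuclideanLin A (z - Matrix.toEuclideanLin T z)‖ ≤ ε * ‖z‖ := by
      have e : Matrix.toEuclideanLin A (z - Matrix.toEuclideanLin T z)
          = Matrix.toEuclideanLin (A - A * T) z := by
        rw [map_sub, map_sub, LinearMap.sub_apply, Matrix.toEuclideanLin_mul_apply A T]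
      rw [e]
      exact (Matrix.norm_toEuclideanLin_le _ _).trans (by gcongr)
    have h2 : ‖Matrix.toEuclideanLin L (z - Matrix.toEuclideanLin T z)‖
        ≤ ‖L * (T - 1)‖ * ‖z‖ := by
      have e : Matrix.toEuclideanLin L (z - Matrix.toEuclideanLin T z)
          = -Matrix.toEuclideanLin (L * (T - 1)) z := by
        rw [map_sub, Matrix.mul_sub, map_sub, Matrix.mul_one, LinearMap.sub_apply,
          Matrix.toEuclideanLin_mul_apply L T]
        abel
      rw [e, norm_neg]
      exact Matrix.norm_toEuclideanLin_le _ _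
    rw [norm_fromRows_apply_sq, norm_smul_toEuclideanLin_sq]
    have h3 := pow_le_pow_left₀ (norm_nonneg _) h1 2
    have h4 := mul_le_mul_of_nonneg_left (pow_le_pow_left₀ (norm_nonneg _) h2 2) (sq_nonneg lam)
    have h5 : 0 ≤ ε * (lam * ‖L * (T - 1)‖) * ‖z‖ ^ 2 := by positivity
    nlinarith

end ErrorBound

/-! ### The relative error in terms of the singular value `sval A k`. -/

theorem mainTheorem3 {m n p : ℕ} (hmn : m ≤ n)
    (A : Matrix (Fin m) (Fin n) ℝ) (L : Matrix (Fin p) (Fin n) ℝ) (hAL : IsGMP A L)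
    (b : EuclideanSpace ℝ (Fin m))
    (k : ℕ) (hk : k < m)
    (ε lam : ℝ) (hε : 0 < ε) (hlam : 0 < lam)
    (c₁ c₂ K₁ K₂ : ℝ)
    (hεσ : |ε - c₁ * sval A k| ≤ K₁ * sval A k ^ 2)
    (hlamσ : |lam - c₂ * sval A k| ≤ K₂ * sval A k ^ 2)
    (U : Matrix (Fin m) (Fin m) ℝ) (V : Matrix (Fin p) (Fin p) ℝ) (X : Matrix (Fin n) (Fin n) ℝ)
    (α β : Fin n → ℝ) (hX : IsGSVD A L U V X α β)
    (xlam : EuclideanSpace ℝ (Fin n)) (hxlam : IsTikhonovSolution A L lam b xlam)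
    (hx0 : xlam ≠ 0) :
    ∀ᵐ ΩQ ∂(uniformMatrixLaw m m),
    ∀ (ℓ₁ : ℕ) (Q : Matrix (Fin n) (Fin ℓ₁) ℝ), IsRangeFinderOutput Aᵀ ε ΩQ Q →
    ∀ᵐ ΩP ∂(uniformMatrixLaw ℓ₁ ℓ₁),
    ∀ (ℓ₂ : ℕ) (P : Matrix (Fin m) (Fin ℓ₂) ℝ), IsRangeFinderOutput (A * Q) ε ΩP P →
    let 𝒜 := Matrix.fromRows A (lam • L)
    let 𝒜P := Matrix.fromRows (P * Pᵀ * A) (lam • L)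
    let 𝒜R := Matrix.fromRows (P * Pᵀ * A * (Q * Qᵀ)) (lam • (L * (Q * Qᵀ)))
    let c := (1 + √5) / 2
    let νt := ‖b‖ / ‖xlam‖
    let ν := ‖pinv 𝒜‖ * νt
    let κ := ‖𝒜‖ * ‖pinv 𝒜‖
    let γ₁ := ‖L * (Q * Qᵀ - 1)‖
    let γ₂ := ‖X⁻¹‖ * √(‖X‖ ^ 2 + c₂ ^ 2)
    let σ := sval A k
    (n ≤ ℓ₂ + L.rank → 𝒜P.rank = n) ∧
    ∀ ξ : ℝ, (ξ = ‖pinv 𝒜R‖ ∨ (𝒜P.rank = n ∧ ξ = ‖pinv 𝒜P‖)) →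
    ∀ xR : EuclideanSpace ℝ (Fin n), IsMinNormLeastSquares 𝒜R (stackedRhs p b) xR →
      ‖xR - xlam‖ / ‖xlam‖ ≤
        ‖pinv 𝒜‖ * (c * c₁ * (ξ * νt + ν) + c * c₂ * γ₁ * ν + (1 + c * κ * ν) * γ₂) * σ
        + ‖pinv 𝒜‖ * (c * K₁ * (ξ * νt + ν) + c * K₂ * γ₁ * ν) * σ ^ 2 := by
  have hσ : 0 ≤ sval A k := LinearMap.singularValues_nonneg _ k
  have hε' : ε ≤ c₁ * sval A k + K₁ * sval A k ^ 2 := by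
    linarith [(abs_le.1 hεσ).2]
  have hlam' : lam ≤ c₂ * sval A k + K₂ * sval A k ^ 2 := by
    linarith [(abs_le.1 hlamσ).2]
  filter_upwards [ae_rank_fromRows_proj hAL ε hlam.ne'] with ΩQ hΩQ ℓ₁ Q hQ
  filter_upwards [hΩQ ℓ₁ Q hQ] with ΩP hΩP ℓ₂ P hP
  intro 𝒜 𝒜P 𝒜R c νt ν κ γ₁ γ₂ σ
  refine ⟨hΩP ℓ₂ P hP, fun ξ hξ xR hxR => ?_⟩
  -- Both choices of `ξ` dominate `‖pinv 𝒜R‖`, which is all the bound needs.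
  have hξR : ‖pinv 𝒜R‖ ≤ ξ := by
    rcases hξ with rfl | ⟨hrank, rfl⟩
    · exact le_rfl
    · have e : 𝒜R = 𝒜P * (Q * Qᵀ) := by
        simp only [𝒜R, 𝒜P]
        rw [Matrix.fromRows_mul, Matrix.smul_mul]
      rw [e]
      refine norm_pinv_mul_le_norm_pinv (Matrix.mulVec_injective_of_rank_eq hrank) ?_ ?_
      · rw [Matrix.transpose_mul, Matrix.transpose_transpose]
      · rw [Matrix.mul_assoc, ← Matrix.mul_assoc Qᵀ, hQ.1, Matrix.one_mul]
  have hbound : ‖xR - xlam‖ ≤ ‖pinv 𝒜‖ * c *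
      ((‖pinv 𝒜R‖ + ‖pinv 𝒜‖) * ε + ‖pinv 𝒜‖ * (lam * γ₁)) * ‖b‖ :=
    norm_twoSided_sub_le hAL hε hlam hQ.1 hQ.2.2 hP.2.2 hxlam hxR
  have hx0' : 0 < ‖xlam‖ := norm_pos_iff.2 hx0
  have ha : 0 ≤ ‖pinv 𝒜‖ := norm_nonneg _
  have hc : 0 ≤ c := by positivity
  have hνt : 0 ≤ νt := by positivity
  have hγ₁ : 0 ≤ γ₁ := norm_nonneg _
  have hγ₂ : 0 ≤ γ₂ := by positivity
  have hν : 0 ≤ ν := by positivity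
  have hκ : 0 ≤ κ := by positivity
  have hξ0 : 0 ≤ ξ := (norm_nonneg _).trans hξR
  calc ‖xR - xlam‖ / ‖xlam‖
      ≤ ‖pinv 𝒜‖ * c * ((‖pinv 𝒜R‖ + ‖pinv 𝒜‖) * ε + ‖pinv 𝒜‖ * (lam * γ₁)) * ‖b‖ / ‖xlam‖ := by
        gcongr
    _ = ‖pinv 𝒜‖ * c * ((‖pinv 𝒜R‖ + ‖pinv 𝒜‖) * ε + ‖pinv 𝒜‖ * (lam * γ₁)) * νt := by
        rw [mul_div_assoc]
    -- The `γ₂` term is nonnegative and enters only as slack.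
    _ ≤ ‖pinv 𝒜‖ * c * ((ξ + ‖pinv 𝒜‖) * (c₁ * σ + K₁ * σ ^ 2)
          + ‖pinv 𝒜‖ * ((c₂ * σ + K₂ * σ ^ 2) * γ₁)) * νt
          + ‖pinv 𝒜‖ * ((1 + c * κ * ν) * γ₂) * σ := by
        refine le_add_of_le_of_nonneg ?_ (by positivity)
        gcongr
    _ = _ := by
        simp only [ν]
        ring
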